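/- A buyer with value $v\in[0,1]$, drawn from a value distribution $F\in\Delta([0,1])$ (a Borel probability measure on $[0,1]$), takes part in a first-price auction. A bidding strategy is a Markov kernel $s$ from $[0,1]$ (values) to $[0,1]$ (bids); let $\mathcal S$ be the set of all of them. If the highest competing bid has distribution $H\in\Delta([0,1])$ and is independent of the value and the bid, the expected utility of $s$ is $$U_F(s,H)=\mathbb E_{(v,h)\sim F\times H}\Big[\mathbb E_{b\sim s(v)}\big[(v-b)\,\mathbf 1\{b\ge h\}\big]\Big],$$ its regret is $\mathrm{Reg}_F(s,H)=\sup_{s'\in\mathcal S}U_F(s',H)-U_F(s,H)$, and the minimax-optimal regret of $F$ is $$R(F)=\inf_{s\in\mathcal S}\ \sup_{H\in\Delta([0,1])}\mathrm{Reg}_F(s,H).$$ For $\rho\in[1,\infty)$ let $\mathcal F_\rho$ be the set of $F\in\Delta([0,1])$ with $F(A)\le\rho\,\lambda(A)$ for every Borel set $A\subseteq[0,1]$, where $\lambda$ is Lebesgue measure, and let $\mathcal F_\infty=\Delta([0,1])$. Let $F_\rho$ be the uniform distribution on $[1-\tfrac1\rho,1]$ if $\rho<\infty$, and $F_\infty=\delta_1$.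 Then, for every $\rho\in[1,\infty]$, $$F_\rho\in\operatorname*{arg\,max}_{F\in\mathcal F_\rho}\ R(F),$$ that is, $F_\rho\in\mathcal F_\rho$ and $R(F)\le R(F_\rho)$ for all $F\in\mathcal F_\rho$. -/

import Mathlib

open MeasureTheory ProbabilityTheory
open scoped ENNReal unitInterval

noncomputable section

namespace FirstPriceAuction

/-- Utility of a buyer with value `v` who bids `b` against highest competing bid `h` in a
first-price auction: `(v - b) * 1{b ≥ h}` (ties are won by the buyer). -/
def bidUtility (b h v : I) : ℝ :=
  if h ≤ b then (v : ℝ) - (b : ℝ) else 0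

/-- A (randomized) bidding strategy: a Markov kernel from values in `[0,1]` to bids in `[0,1]`. -/
def Strategy : Type := {κ : Kernel I I // IsMarkovKernel κ}

instance (s : Strategy) : IsMarkovKernel s.1 := s.2

instance : Nonempty Strategy := ⟨⟨Kernel.id, inferInstance⟩⟩

/-- Expected utility of the strategy `s` when the value `v ∼ F` and the highest competing bid
`h ∼ H` are independent and the bid is drawn from `s v`. -/
def expectedUtility (F : ProbabilityMeasure I) (s : Strategy) (H : ProbabilityMeasure I) : ℝ :=
  ∫ p : I × I, (∫ b, bidUtility b p.2 p.1 ∂(s.1 p.1)) ∂((F : Measure I).prod (H : Measure I))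

/-- Regret of `s` against the distribution `H` of the highest competing bid: the benchmark is
the best expected utility attainable by a strategy that knows `H`. -/
def regret (F : ProbabilityMeasure I) (s : Strategy) (H : ProbabilityMeasure I) : ℝ :=
  (⨆ s' : Strategy, expectedUtility F s' H) - expectedUtility F s H

/-- Worst-case regret of `s` over all distributions of the highest competing bid. -/
def worstCaseRegret (F : ProbabilityMeasure I) (s : Strategy) : ℝ :=
  ⨆ H : ProbabilityMeasure I, regret F s H

/-- The minimax-optimal regret for the value distribution `F`. -/
def minimaxRegret (F : ProbabilityMeasure I) : ℝ :=
  ⨅ s : Strategy, worstCaseRegret F s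

/-- The value distributions on `[0,1]` whose density is bounded above by `ρ`; for `ρ = ∞` these
are all probability measures on `[0,1]` (in particular atoms are allowed). -/
def boundedDensityClass (ρ : ℝ≥0∞) : Set (ProbabilityMeasure I) :=
  {F | ρ ≠ ∞ → ∀ A : Set I, MeasurableSet A → (F : Measure I) A ≤ ρ * volume A}

/-- The uniform distribution on `[a, 1]`, for `a < 1`. -/
def uniformAbove (a : I) (ha : a < 1) : ProbabilityMeasure I :=
  ⟨(volume : Measure I)[|Set.Icc a 1], by
    apply cond_isProbabilityMeasure
    have h : (a : ℝ) < 1 := ha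
    simpa using h⟩

/-- The point `1 - 1/ρ` of `[0,1]`, for `1 ≤ ρ` (it is `1` when `ρ = ∞`). -/
def lowerEndpoint (ρ : ℝ≥0∞) (hρ : 1 ≤ ρ) : I :=
  ⟨1 - (ρ⁻¹).toReal, by
    have h1 : (ρ⁻¹).toReal ≤ 1 :=
      ENNReal.toReal_le_of_le_ofReal zero_le_one (by simpa using hρ)
    have h0 : 0 ≤ (ρ⁻¹).toReal := ENNReal.toReal_nonneg
    constructor <;> linarith⟩

theorem lowerEndpoint_lt_one (ρ : ℝ≥0∞) (hρ : 1 ≤ ρ) (hfin : ρ ≠ ∞) :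
    lowerEndpoint ρ hρ < 1 := by
  have hpos : 0 < (ρ⁻¹).toReal :=
    ENNReal.toReal_pos (ENNReal.inv_ne_zero.2 hfin)
      (ENNReal.inv_ne_top.2 (zero_lt_one.trans_le hρ).ne')
  change (1 : ℝ) - (ρ⁻¹).toReal < 1
  linarith

open Classical in
/-- `Unif(1 - 1/ρ, 1)`, with the convention that this is the Dirac mass at `1` for `ρ = ∞`. -/
def worstValueDistribution (ρ : ℝ≥0∞) (hρ : 1 ≤ ρ) : ProbabilityMeasure I :=
  if hfin : ρ = ∞ then ⟨Measure.dirac 1, inferInstance⟩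
  else uniformAbove (lowerEndpoint ρ hρ) (lowerEndpoint_lt_one ρ hρ hfin)

/-! The integrals, suprema and infima above are genuine: the integrands are bounded and
measurable, and the families over which extrema are taken are bounded. -/

theorem abs_bidUtility_le (b h v : I) : |bidUtility b h v| ≤ 1 := by
  unfold bidUtility
  split_ifs
  · rw [abs_le]
    constructor <;> linarith [b.2.1, b.2.2, v.2.1, v.2.2]
  · simp

theorem measurable_bidUtility :
    Measurable (fun q : (I × I) × I => bidUtility q.2 q.1.2 q.1.1) := by
  unfold bidUtility
  refine Measurable.ite (measurableSet_le (by fun_prop) (by fun_prop)) ?_ measurable_const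
  fun_prop

theorem abs_expectedBidUtility_le (s : Strategy) (p : I × I) :
    |∫ b, bidUtility b p.2 p.1 ∂(s.1 p.1)| ≤ 1 := by
  have h := norm_integral_le_of_norm_le_const (μ := s.1 p.1)
    (f := fun b => bidUtility b p.2 p.1) (C := 1)
    (Filter.Eventually.of_forall fun b => abs_bidUtility_le b p.2 p.1)
  simpa using h

theorem integrable_bidUtility (s : Strategy) (p : I × I) :
    Integrable (fun b => bidUtility b p.2 p.1) (s.1 p.1) :=
  Integrable.of_bound
    (measurable_bidUtility.comp (measurable_const.prodMk measurable_id)).aestronglyMeasurable 1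
    (Filter.Eventually.of_forall fun b => abs_bidUtility_le b p.2 p.1)

theorem integrable_expectedBidUtility (F : ProbabilityMeasure I) (s : Strategy)
    (H : ProbabilityMeasure I) :
    Integrable (fun p : I × I => ∫ b, bidUtility b p.2 p.1 ∂(s.1 p.1))
      ((F : Measure I).prod (H : Measure I)) := by
  have hm : StronglyMeasurable
      (fun p : I × I => ∫ b, bidUtility b p.2 p.1 ∂((s.1.comap Prod.fst measurable_fst) p)) :=
    StronglyMeasurable.integral_kernel_prod_right' (κ := s.1.comap Prod.fst measurable_fst)
      measurable_bidUtility.stronglyMeasurable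
  refine Integrable.of_bound hm.aestronglyMeasurable 1
    (Filter.Eventually.of_forall fun p => ?_)
  exact abs_expectedBidUtility_le s p

theorem abs_expectedUtility_le (F : ProbabilityMeasure I) (s : Strategy)
    (H : ProbabilityMeasure I) : |expectedUtility F s H| ≤ 1 := by
  have h := norm_integral_le_of_norm_le_const (μ := (F : Measure I).prod (H : Measure I))
    (f := fun p : I × I => ∫ b, bidUtility b p.2 p.1 ∂(s.1 p.1)) (C := 1)
    (Filter.Eventually.of_forall fun p => abs_expectedBidUtility_le s p)
  simpa [expectedUtility] using h

theorem bddAbove_expectedUtility (F H : ProbabilityMeasure I) :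
    BddAbove (Set.range fun s : Strategy => expectedUtility F s H) :=
  ⟨1, by rintro _ ⟨s, rfl⟩; exact (abs_le.1 (abs_expectedUtility_le F s H)).2⟩

theorem regret_nonneg (F : ProbabilityMeasure I) (s : Strategy) (H : ProbabilityMeasure I) :
    0 ≤ regret F s H :=
  sub_nonneg.2 (le_ciSup (bddAbove_expectedUtility F H) s)

theorem bddAbove_regret (F : ProbabilityMeasure I) (s : Strategy) :
    BddAbove (Set.range fun H : ProbabilityMeasure I => regret F s H) := by
  refine ⟨2, ?_⟩
  rintro _ ⟨H, rfl⟩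
  have h1 : (⨆ s' : Strategy, expectedUtility F s' H) ≤ 1 :=
    ciSup_le fun s' => (abs_le.1 (abs_expectedUtility_le F s' H)).2
  have h2 := (abs_le.1 (abs_expectedUtility_le F s H)).1
  change (⨆ s' : Strategy, expectedUtility F s' H) - expectedUtility F s H ≤ 2
  linarith

theorem bddBelow_worstCaseRegret (F : ProbabilityMeasure I) :
    BddBelow (Set.range fun s : Strategy => worstCaseRegret F s) :=
  ⟨0, by rintro _ ⟨s, rfl⟩; exact Real.iSup_nonneg fun H => regret_nonneg F s H⟩

end FirstPriceAuction

end

open MeasureTheory ProbabilityTheory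
open scoped ENNReal unitInterval

noncomputable section

namespace FirstPriceAuction

/-! The value of this problem rises when values move up. Regret is controlled by deterministic
competing bids: the benchmark at a known `h` is `max (v - h) 0`, so regret against `H` is at most
the `H`-average of `pointRegret` (`regret_le_of_pointRegret_le`), while point masses attain it
(`pointRegret_le_worstCaseRegret`). If `w` pushes `F` to `G` and `v ≤ w v`, a buyer facing `F` can
imitate a strategy for `G` by bidding as if the value were `w v`, capped at `v`; the loss never
grows (`gap_min_le`), so `minimaxRegret F ≤ minimaxRegret G`. Finally, the density bound makes the
extremal distribution reachable by such a map: the distribution function of `F` followed by the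
quantile function of the uniform law. -/

/-! ### Reduction to deterministic competing bids -/

/-- Regret of `s` against the known highest competing bid `h`. -/
def pointRegret (F : ProbabilityMeasure I) (s : Strategy) (h : I) : ℝ :=
  ∫ v : I, (max ((v : ℝ) - h) 0 - ∫ b, bidUtility b h v ∂(s.1 v)) ∂(F : Measure I)

theorem bidUtility_le_max (b h v : I) : bidUtility b h v ≤ max ((v : ℝ) - h) 0 := by
  unfold bidUtility
  split_ifs with hb
  · have : (h : ℝ) ≤ b := hb
    exact le_max_of_le_left (by linarith)
  · exact le_max_right _ _

theorem integral_bidUtility_le_max (s : Strategy) (p : I × I) :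
    ∫ b, bidUtility b p.2 p.1 ∂(s.1 p.1) ≤ max ((p.1 : ℝ) - p.2) 0 := by
  calc ∫ b, bidUtility b p.2 p.1 ∂(s.1 p.1)
      ≤ ∫ _b, max ((p.1 : ℝ) - p.2) 0 ∂(s.1 p.1) :=
        integral_mono (integrable_bidUtility s p) (integrable_const _)
          fun b => bidUtility_le_max b p.2 p.1
    _ = _ := by simp

theorem integrable_max_sub (μ : Measure (I × I)) [IsFiniteMeasure μ] :
    Integrable (fun p : I × I => max ((p.1 : ℝ) - p.2) 0) μ := by
  refine Integrable.of_bound (by fun_prop) 1 (Filter.Eventually.of_forall fun p => ?_)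
  rw [Real.norm_eq_abs, abs_of_nonneg (le_max_right _ _)]
  exact max_le (by linarith [p.1.2.2, p.2.2.1]) zero_le_one

theorem integrable_gap (F : ProbabilityMeasure I) (s : Strategy) (H : ProbabilityMeasure I) :
    Integrable (fun p : I × I => max ((p.1 : ℝ) - p.2) 0 - ∫ b, bidUtility b p.2 p.1 ∂(s.1 p.1))
      ((F : Measure I).prod (H : Measure I)) :=
  (integrable_max_sub _).sub (integrable_expectedBidUtility F s H)

theorem measurable_gap (s : Strategy) (h : I) :
    Measurable (fun v : I => max ((v : ℝ) - h) 0 - ∫ b, bidUtility b h v ∂(s.1 v)) := by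
  have hm : StronglyMeasurable (fun v : I => ∫ b, bidUtility b h v ∂(s.1 v)) :=
    StronglyMeasurable.integral_kernel_prod_right' (κ := s.1)
      (f := fun q : I × I => bidUtility q.2 h q.1)
      (measurable_bidUtility.comp (g := fun q : (I × I) × I => bidUtility q.2 q.1.2 q.1.1)
        (f := fun q : I × I => ((q.1, h), q.2)) (by fun_prop)).stronglyMeasurable
  exact Measurable.sub (by fun_prop) hm.measurable

theorem abs_gap_le (s : Strategy) (h v : I) :
    |max ((v : ℝ) - h) 0 - ∫ b, bidUtility b h v ∂(s.1 v)| ≤ 2 := by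
  have h1 := abs_expectedBidUtility_le s (v, h)
  have h2 : max ((v : ℝ) - h) 0 ≤ 1 := max_le (by linarith [v.2.2, h.2.1]) zero_le_one
  have h3 : 0 ≤ max ((v : ℝ) - h) 0 := le_max_right _ _
  rw [abs_le] at h1 ⊢
  constructor <;> linarith [h1.1, h1.2]

theorem integrable_gap_apply (μ : Measure I) [IsFiniteMeasure μ] (s : Strategy) (h : I) :
    Integrable (fun v : I => max ((v : ℝ) - h) 0 - ∫ b, bidUtility b h v ∂(s.1 v)) μ :=
  Integrable.of_bound (measurable_gap s h).aestronglyMeasurable 2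
    (Filter.Eventually.of_forall fun v => abs_gap_le s h v)

/-- No bid earns more than `max (v - h) 0`, which bounds the benchmark even by strategies that see
`h`; Fubini then averages over `h`. -/
theorem regret_le_of_pointRegret_le (F : ProbabilityMeasure I) (s : Strategy)
    (H : ProbabilityMeasure I) {c : ℝ} (hc : ∀ h, pointRegret F s h ≤ c) :
    regret F s H ≤ c := by
  have hsup : (⨆ s' : Strategy, expectedUtility F s' H) ≤
      ∫ p : I × I, max ((p.1 : ℝ) - p.2) 0 ∂((F : Measure I).prod (H : Measure I)) :=
    ciSup_le fun s' => integral_mono (integrable_expectedBidUtility F s' H)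
      (integrable_max_sub _) (integral_bidUtility_le_max s')
  calc regret F s H
      ≤ ∫ p : I × I, (max ((p.1 : ℝ) - p.2) 0 - ∫ b, bidUtility b p.2 p.1 ∂(s.1 p.1))
          ∂((F : Measure I).prod (H : Measure I)) := by
        rw [integral_sub (integrable_max_sub _) (integrable_expectedBidUtility F s H)]
        exact sub_le_sub_right hsup _
    _ = ∫ h, pointRegret F s h ∂(H : Measure I) := integral_prod_symm _ (integrable_gap F s H)
    _ ≤ ∫ _h, c ∂(H : Measure I) :=
        integral_mono (integrable_gap F s H).integral_prod_right (integrable_const _) hc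
    _ = c := by simp

/-- The point mass at `h`. -/
def diracAt (h : I) : ProbabilityMeasure I := ⟨Measure.dirac h, inferInstance⟩

theorem expectedUtility_diracAt (F : ProbabilityMeasure I) (s : Strategy) (h : I) :
    expectedUtility F s (diracAt h) = ∫ v, ∫ b, bidUtility b h v ∂(s.1 v) ∂(F : Measure I) := by
  unfold expectedUtility
  rw [integral_prod _ (integrable_expectedBidUtility F s (diracAt h))]
  refine integral_congr_ae (Filter.Eventually.of_forall fun v => ?_)
  exact integral_dirac _ h

/-- The best response to a known highest competing bid `h`: bid `h` if this is at most the value,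
and the value otherwise. -/
def bidMin (h : I) : Strategy :=
  ⟨Kernel.deterministic (fun v => min h v) (by fun_prop), inferInstance⟩

theorem integral_bidMin (h v : I) :
    ∫ b, bidUtility b h v ∂((bidMin h).1 v) = max ((v : ℝ) - h) 0 := by
  change ∫ b, bidUtility b h v ∂(Kernel.deterministic (fun v => min h v) (by fun_prop) v) = _
  rw [Kernel.deterministic_apply, integral_dirac]
  unfold bidUtility
  rcases le_total h v with hv | hv
  · have : (h : ℝ) ≤ v := hv
    simp [hv, this]
  · have h1 : (v : ℝ) ≤ h := hv
    rw [min_eq_right hv, max_eq_right (by linarith)]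
    simp

/-- Against the point mass at `h`, `bidMin h` earns `max (v - h) 0` at every value, so the benchmark
is no smaller than its mean. -/
theorem pointRegret_le_worstCaseRegret (F : ProbabilityMeasure I) (s : Strategy) (h : I) :
    pointRegret F s h ≤ worstCaseRegret F s := by
  refine le_trans ?_ (le_ciSup (bddAbove_regret F s) (diracAt h))
  have hi : ∀ t : Strategy,
      Integrable (fun v => ∫ b, bidUtility b h v ∂(t.1 v)) (F : Measure I) := fun t =>
    (integrable_expectedBidUtility F t (diracAt h)).integral_prod_left.congr
      (Filter.Eventually.of_forall fun v => integral_dirac _ h)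
  have hb := hi (bidMin h)
  have hsup := le_ciSup (bddAbove_expectedUtility F (diracAt h)) (bidMin h)
  rw [expectedUtility_diracAt] at hsup
  simp only [integral_bidMin] at hsup hb
  unfold pointRegret regret
  rw [integral_sub hb (hi s), expectedUtility_diracAt]
  exact sub_le_sub_right hsup _

/-! ### Monotonicity under upward transport of values -/

/-- Bid as `s` would with the value `w v` in place of `v`, but never above `v`. -/
def cappedStrategy (s : Strategy) (w : I → I) (hw : Measurable w) : Strategy :=
  ⟨(Kernel.id ×ₖ s.1.comap w hw).map (fun p : I × I => min p.1 p.2),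
    Kernel.IsMarkovKernel.map _ (by fun_prop)⟩

theorem cappedStrategy_apply (s : Strategy) (w : I → I) (hw : Measurable w) (v : I) :
    (cappedStrategy s w hw).1 v = (s.1 (w v)).map (fun b => min v b) := by
  change ((Kernel.id ×ₖ s.1.comap w hw).map (fun p : I × I => min p.1 p.2)) v = _
  rw [Kernel.map_apply _ (by fun_prop), Kernel.prod_apply, Kernel.id_apply, Kernel.comap_apply,
    Measure.dirac_prod, Measure.map_map (by fun_prop) (by fun_prop)]
  rfl

/-- A winning bid `b` loses exactly `b - h` against the ideal payoff when `h` is at most the value,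
whatever the value; capping only lowers this overpayment. If the cap turns a win into a defeat, then
`v < h` and nothing is lost. If both bids lose, the gap is the ideal payoff, monotone in the value.
-/
theorem gap_min_le (b h v w : I) (hvw : v ≤ w) :
    max ((v : ℝ) - h) 0 - bidUtility (min v b) h v ≤ max ((w : ℝ) - h) 0 - bidUtility b h w := by
  have hvw' : (v : ℝ) ≤ w := hvw
  unfold bidUtility
  rcases le_total v b with hv | hv
  · have hv' : (v : ℝ) ≤ b := hv
    rw [min_eq_left hv]
    split_ifs with h1 h2 h2
    · have h1' : (h : ℝ) ≤ v := h1
      rw [max_eq_left (by linarith), max_eq_left (by linarith)]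
      linarith
    · exact absurd (h1.trans hv) h2
    · have h1' : (v : ℝ) < h := not_le.1 h1
      have h2' : (h : ℝ) ≤ b := h2
      rw [max_eq_right (by linarith)]
      linarith [le_max_left ((w : ℝ) - h) 0]
    · linarith [max_le_max_right (0 : ℝ) (sub_le_sub_right hvw' (h : ℝ))]
  · rw [min_eq_right hv]
    have hv' : (b : ℝ) ≤ v := hv
    split_ifs with h1
    · have h1' : (h : ℝ) ≤ b := h1
      rw [max_eq_left (by linarith), max_eq_left (by linarith)]
      linarith
    · linarith [max_le_max_right (0 : ℝ) (sub_le_sub_right hvw' (h : ℝ))]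

theorem gap_cappedStrategy_le (s : Strategy) (w : I → I) (hw : Measurable w) (h v : I)
    (hv : v ≤ w v) :
    max ((v : ℝ) - h) 0 - ∫ b, bidUtility b h v ∂((cappedStrategy s w hw).1 v) ≤
      max ((w v : ℝ) - h) 0 - ∫ b, bidUtility b h (w v) ∂(s.1 (w v)) := by
  have hm : Measurable fun b => bidUtility b h v :=
    measurable_bidUtility.comp (g := fun q : (I × I) × I => bidUtility q.2 q.1.2 q.1.1)
      (f := fun b : I => ((v, h), b)) (by fun_prop)
  rw [cappedStrategy_apply, integral_map (by fun_prop) hm.aestronglyMeasurable]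
  have h1 : Integrable (fun b => bidUtility (min v b) h v) (s.1 (w v)) :=
    Integrable.of_bound (hm.comp (by fun_prop : Measurable fun b => min v b)).aestronglyMeasurable
      1 (Filter.Eventually.of_forall fun b => abs_bidUtility_le _ h v)
  have h2 := integrable_bidUtility s (w v, h)
  have key := integral_mono ((integrable_const (max ((v : ℝ) - h) 0)).sub h1)
    ((integrable_const (max ((w v : ℝ) - h) 0)).sub h2)
    fun b => gap_min_le b h v (w v) hv
  simp only [Pi.sub_apply] at key
  rw [integral_sub (integrable_const _) h1, integral_sub (integrable_const _) h2] at key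
  simpa using key

/-- The minimax-optimal regret is monotone with respect to first-order stochastic dominance
witnessed by a transport map. -/
theorem minimaxRegret_le_of_map_eq (F G : ProbabilityMeasure I) (w : I → I) (hw : Measurable w)
    (hle : ∀ v, v ≤ w v) (hmap : (F : Measure I).map w = G) :
    minimaxRegret F ≤ minimaxRegret G := by
  refine le_ciInf fun s =>
    (ciInf_le (bddBelow_worstCaseRegret F) (cappedStrategy s w hw)).trans ?_
  have : Nonempty (ProbabilityMeasure I) := ⟨F⟩
  refine ciSup_le fun H => regret_le_of_pointRegret_le F _ H fun h =>
    le_trans ?_ (pointRegret_le_worstCaseRegret G s h)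
  unfold pointRegret
  rw [← hmap, integral_map hw.aemeasurable (measurable_gap s h).aestronglyMeasurable]
  refine integral_mono (integrable_gap_apply _ _ h) ?_
    fun v => gap_cappedStrategy_le s w hw h v (hle v)
  exact Integrable.of_bound ((measurable_gap s h).comp hw).aestronglyMeasurable 2
    (Filter.Eventually.of_forall fun v => abs_gap_le s h (w v))

/-! ### Probability integral transform -/

section ProbabilityIntegralTransform

variable (F : Measure I) [IsProbabilityMeasure F]

theorem monotone_real_Iic : Monotone fun v : I => F.real (Set.Iic v) :=
  fun _ _ h => measureReal_mono (Set.Iic_subset_Iic.2 h)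

/-- The density bound makes the distribution function `r`-Lipschitz. -/
theorem continuous_real_Iic {r : ℝ} (hr : 0 ≤ r)
    (hF : ∀ A : Set I, MeasurableSet A → F.real A ≤ r * (volume : Measure I).real A) :
    Continuous fun v : I => F.real (Set.Iic v) := by
  have key : ∀ x y : I, x ≤ y → F.real (Set.Iic y) ≤ F.real (Set.Iic x) + r * dist x y := by
    intro x y hxy
    have h1 : F.real (Set.Iic y) ≤ F.real (Set.Iic x) + F.real (Set.Ioc x y) := by
      rw [← Set.Iic_union_Ioc_eq_Iic hxy]
      exact measureReal_union_le _ _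
    have h2 := hF (Set.Ioc x y) measurableSet_Ioc
    have hxy' : (x : ℝ) ≤ y := hxy
    have h3 : (volume : Measure I).real (Set.Ioc x y) = dist x y := by
      rw [measureReal_def, unitInterval.volume_Ioc, Subtype.dist_eq, Real.dist_eq, abs_sub_comm,
        abs_of_nonneg (by linarith), ENNReal.toReal_ofReal (by linarith)]
    rw [h3] at h2
    linarith
  refine (LipschitzWith.of_le_add_mul ⟨r, hr⟩ fun x y => ?_).continuous
  rcases le_total x y with h | h
  · have := monotone_real_Iic F h
    exact this.trans (le_add_of_nonneg_right (mul_nonneg hr dist_nonneg))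
  · rw [dist_comm]
    exact key y x h

/-- The distribution function of a measure with continuous distribution function is uniformly
distributed. -/
theorem real_setOf_real_Iic_le (hc : Continuous fun v : I => F.real (Set.Iic v))
    (h0 : F.real (Set.Iic 0) = 0) {u : ℝ} (hu0 : 0 ≤ u) (hu1 : u ≤ 1) :
    F.real {v : I | F.real (Set.Iic v) ≤ u} = u := by
  have hclosed : IsClosed {v : I | F.real (Set.Iic v) ≤ u} := isClosed_le hc continuous_const
  -- By monotonicity the sublevel set is an initial segment ending at `x`; by the intermediate value
  -- theorem `u` is attained, necessarily at a point below `x`.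
  obtain ⟨x, hx, hmax⟩ := hclosed.isCompact.exists_isGreatest ⟨0, by simpa [h0] using hu0⟩
  have hset : {v : I | F.real (Set.Iic v) ≤ u} = Set.Iic x :=
    Set.Subset.antisymm (fun v hv => hmax hv) fun v hv => (monotone_real_Iic F hv).trans hx
  have h1 : F.real (Set.Iic (1 : I)) = 1 := by
    rw [show Set.Iic (1 : I) = Set.univ from Set.Iic_top]
    exact probReal_univ
  obtain ⟨y, hy⟩ := mem_range_of_exists_le_of_exists_ge (c := u) hc ⟨0, h0.trans_le hu0⟩
    ⟨1, hu1.trans_eq h1.symm⟩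
  rw [hset]
  exact le_antisymm hx (hy.symm.le.trans (monotone_real_Iic F (hmax hy.le)))

end ProbabilityIntegralTransform

/-! ### The extremal distribution -/

theorem volume_Icc_lowerEndpoint (ρ : ℝ≥0∞) (hρ : 1 ≤ ρ) :
    volume (Set.Icc (lowerEndpoint ρ hρ) 1) = ρ⁻¹ := by
  rw [unitInterval.volume_Icc]
  simp only [lowerEndpoint, Set.Icc.coe_one, sub_sub_cancel]
  exact ENNReal.ofReal_toReal (ENNReal.inv_ne_top.2 (zero_lt_one.trans_le hρ).ne')

theorem uniformAbove_apply (ρ : ℝ≥0∞) (hρ : 1 ≤ ρ) (hfin : ρ ≠ ∞) (A : Set I) :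
    (uniformAbove (lowerEndpoint ρ hρ) (lowerEndpoint_lt_one ρ hρ hfin) : Measure I) A =
      ρ * volume (Set.Icc (lowerEndpoint ρ hρ) 1 ∩ A) := by
  change ((volume : Measure I)[|Set.Icc (lowerEndpoint ρ hρ) 1]) A = _
  rw [cond_apply measurableSet_Icc, volume_Icc_lowerEndpoint, inv_inv]

theorem worstValueDistribution_of_eq_top (ρ : ℝ≥0∞) (hρ : 1 ≤ ρ) (h : ρ = ∞) :
    worstValueDistribution ρ hρ = diracAt 1 :=
  dif_pos h

theorem worstValueDistribution_of_ne_top (ρ : ℝ≥0∞) (hρ : 1 ≤ ρ) (h : ρ ≠ ∞) :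
    worstValueDistribution ρ hρ =
      uniformAbove (lowerEndpoint ρ hρ) (lowerEndpoint_lt_one ρ hρ h) :=
  dif_neg h

theorem worstValueDistribution_mem (ρ : ℝ≥0∞) (hρ : 1 ≤ ρ) :
    worstValueDistribution ρ hρ ∈ boundedDensityClass ρ := by
  intro hfin A _
  rw [worstValueDistribution_of_ne_top ρ hρ hfin, uniformAbove_apply ρ hρ hfin]
  gcongr
  exact Set.inter_subset_right

theorem minimaxRegret_le_worstValueDistribution (ρ : ℝ≥0∞) (hρ : 1 ≤ ρ) (F : ProbabilityMeasure I)
    (hF : F ∈ boundedDensityClass ρ) :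
    minimaxRegret F ≤ minimaxRegret (worstValueDistribution ρ hρ) := by
  by_cases hfin : ρ = ∞
  · rw [worstValueDistribution_of_eq_top ρ hρ hfin]
    refine minimaxRegret_le_of_map_eq F _ (fun _ => 1) measurable_const (fun v => le_top) ?_
    simp [Measure.map_const, diracAt]
  rw [worstValueDistribution_of_ne_top ρ hρ hfin]
  set r : ℝ := ρ.toReal with hr
  have hr1 : 1 ≤ r := by
    simpa using ENNReal.toReal_mono hfin hρ
  have hrpos : 0 < r := by linarith
  have hFr : ∀ A : Set I, MeasurableSet A →
      (F : Measure I).real A ≤ r * (volume : Measure I).real A := by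
    intro A hA
    have := ENNReal.toReal_mono (ENNReal.mul_ne_top hfin (measure_ne_top _ _)) (hF hfin A hA)
    rwa [ENNReal.toReal_mul] at this
  have hcont := continuous_real_Iic (F : Measure I) hrpos.le hFr
  have h0 : (F : Measure I).real (Set.Iic 0) = 0 := by
    refine le_antisymm ((hFr _ measurableSet_Iic).trans ?_) measureReal_nonneg
    simp [measureReal_def]
  have hc1 : ∀ v : I, (F : Measure I).real (Set.Iic v) ≤ 1 := fun v => measureReal_le_one
  have hc0 : ∀ v : I, 0 ≤ (F : Measure I).real (Set.Iic v) := fun v => measureReal_nonneg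
  -- The mass above `v` is at most `r` times the length `1 - v`; this is exactly what gives `v ≤ w
  -- v` below.
  have hdom : ∀ v : I, 1 - (F : Measure I).real (Set.Iic v) ≤ r * (1 - v) := by
    intro v
    have h1 := hFr (Set.Ioi v) measurableSet_Ioi
    rw [← Set.compl_Iic, probReal_compl_eq_one_sub measurableSet_Iic, Set.compl_Iic,
      measureReal_def volume, unitInterval.volume_Ioi,
      ENNReal.toReal_ofReal (by linarith [v.2.2])] at h1
    exact h1
  -- The quantile function of the uniform law on `[1 - 1/r, 1]` is `u ↦ 1 - (1 - u) / r`, here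
  -- evaluated at the distribution function of `F`.
  let w : I → I := fun v => ⟨1 - (1 - (F : Measure I).real (Set.Iic v)) / r, by
    have h1 : (1 - (F : Measure I).real (Set.Iic v)) / r ≤ 1 := by
      rw [div_le_one hrpos]; linarith [hc0 v]
    have h2 : 0 ≤ (1 - (F : Measure I).real (Set.Iic v)) / r :=
      div_nonneg (by linarith [hc1 v]) hrpos.le
    constructor <;> linarith⟩
  have hwc : Continuous w :=
    Continuous.subtype_mk (continuous_const.sub ((continuous_const.sub hcont).div_const r)) _
  refine minimaxRegret_le_of_map_eq F _ w hwc.measurable (fun v => ?_) ?_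
  · change (v : ℝ) ≤ 1 - (1 - (F : Measure I).real (Set.Iic v)) / r
    have := (div_le_iff₀' hrpos).2 (hdom v)
    linarith
  have := Measure.isProbabilityMeasure_map (μ := (F : Measure I)) hwc.measurable.aemeasurable
  refine Measure.ext_of_Iic _ _ fun t => ?_
  have hpre : w ⁻¹' Set.Iic t =
      {v | (F : Measure I).real (Set.Iic v) ≤ 1 - r * (1 - t)} := by
    ext v
    change 1 - (1 - (F : Measure I).real (Set.Iic v)) / r ≤ (t : ℝ) ↔
      (F : Measure I).real (Set.Iic v) ≤ 1 - r * (1 - t)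
    rw [sub_le_comm, le_div_iff₀' hrpos]
    constructor <;> intro h <;> linarith
  have hend : (lowerEndpoint ρ hρ : ℝ) = 1 - r⁻¹ := by
    simp [lowerEndpoint, hr, ENNReal.toReal_inv]
  rw [Measure.map_apply hwc.measurable measurableSet_Iic, hpre, uniformAbove_apply ρ hρ hfin,
    show Set.Icc (lowerEndpoint ρ hρ) 1 ∩ Set.Iic t = Set.Icc (lowerEndpoint ρ hρ) t by
      ext x
      simp only [Set.mem_inter_iff, Set.mem_Icc, Set.mem_Iic]
      exact ⟨fun h => ⟨h.1.1, h.2⟩, fun h => ⟨⟨h.1, x.2.2⟩, h.2⟩⟩,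
    unitInterval.volume_Icc, hend, ← ENNReal.ofReal_toReal hfin, ← hr,
    ← ENNReal.ofReal_mul hrpos.le,
    show r * ((t : ℝ) - (1 - r⁻¹)) = 1 - r * (1 - t) by field_simp; ring]
  -- The negative case is `t` below the lower endpoint, where both measures vanish.
  rcases lt_or_ge (1 - r * (1 - (t : ℝ))) 0 with hu | hu
  · rw [ENNReal.ofReal_of_nonpos hu.le]
    refine measure_mono_null (fun v hv => ?_) measure_empty
    exact absurd ((hc0 v).trans hv) (not_le.2 hu)
  · have hu1 : 1 - r * (1 - (t : ℝ)) ≤ 1 := by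
      linarith [mul_nonneg hrpos.le (sub_nonneg.2 t.2.2)]
    rw [← ofReal_measureReal, real_setOf_real_Iic_le (F : Measure I) hcont h0 hu hu1]

end FirstPriceAuction

end

theorem mainTheorem4 (ρ : ℝ≥0∞) (hρ : 1 ≤ ρ) :
    FirstPriceAuction.worstValueDistribution ρ hρ ∈ FirstPriceAuction.boundedDensityClass ρ ∧
      IsMaxOn FirstPriceAuction.minimaxRegret (FirstPriceAuction.boundedDensityClass ρ)
        (FirstPriceAuction.worstValueDistribution ρ hρ) :=
  ⟨FirstPriceAuction.worstValueDistribution_mem ρ hρ, fun F hF =>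
    FirstPriceAuction.minimaxRegret_le_worstValueDistribution ρ hρ F hF⟩
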